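/- Theorem 1. Let $\alpha>0$ and $\omega\in\mathbb R$. On a probability space let $B=(B_t)_{t\ge0}$ be a standard Brownian motion, let $X_0\sim N(0,\alpha^2)$ be independent of $B$, let $X=(X_t)_{t\ge 0}$ be the Ornstein–Uhlenbeck process with initial value $X_0$ and $$dX_t=-\alpha X_t\,dt+\alpha^{3/2}\,dB_t,$$ and put $Y_t:=e^{-\omega t}\bigl(1+\int_0^tX_s\,ds\bigr)$, $t\ge0$. Let $$W(s,t):=e^{-\omega(s+t)}\Bigl(\alpha\min(s,t)-e^{-\alpha\max(s,t)}\sinh\bigl(\alpha\min(s,t)\bigr)\Bigr),\qquad s,t\ge0.$$ Then $Y$ is a Gaussian process with $\mathbb E[Y_t]=e^{-\omega t}$ and $\operatorname{Cov}[Y_s,Y_t]=W(s,t)$ for all $s,t\ge0$. Moreover, for all distinct tenors $u_1,\dots,u_N>0$ and all prices $p_1,\dots,p_N\in\mathbb R$ there is exactly one $\zeta\in\mathbb R^N$ for which the Smith–Wilson discount curve $$P(t):=e^{-\omega t}+\sum_{j=1}^N\zeta_jW(t,u_j),\qquad t\ge0,$$ satisfies $P(u_i)=p_i$ for $i=1,\dots,N$,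 and for this $\zeta$ $$P(t)=\mathbb E\bigl[Y_t\,\big|\,Y_{u_i}=p_i,\ i=1,\dots,N\bigr]\qquad\text{for all }t\ge0.$$ Here $Y_t$ is integrable, $\mathbb E[Y_t\mid Y_{u_i}=x_i,\ i=1,\dots,N]$ denotes the value at $x$ of the continuous version of the conditional expectation of $Y_t$ given $(Y_{u_1},\dots,Y_{u_N})$, and this version is unique because the law of $(Y_{u_1},\dots,Y_{u_N})$ has full support in $\mathbb R^N$. -/

import Mathlib

open MeasureTheory ProbabilityTheory
open scoped NNReal

namespace SmithWilson

noncomputable section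

/-- The Wilson function
`W(s,t) = e^{-ω(s+t)} (α (s ∧ t) - e^{-α (s ∨ t)} sinh (α (s ∧ t)))`. -/
def wilson (α ω s t : ℝ) : ℝ :=
  Real.exp (-ω * (s + t)) *
    (α * min s t - Real.exp (-α * max s t) * Real.sinh (α * min s t))

/-- The curve `P(t) = e^{-ω t} + ∑ j, ζ j * W(t, u j)` with tenors `u` and weights `ζ`. -/
def discountFactor {N : ℕ} (α ω : ℝ) (u : Fin N → ℝ≥0) (ζ : Fin N → ℝ) (t : ℝ≥0) : ℝ :=
  Real.exp (-ω * t) + ∑ j, ζ j * wilson α ω t (u j)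

/-- The weights `ζ` solve the linear system saying that the curve `P` reproduces the
prices `p` at the tenors `u`: `P(u i) = p i` for all `i`. -/
def IsFit {N : ℕ} (α ω : ℝ) (u : Fin N → ℝ≥0) (p ζ : Fin N → ℝ) : Prop :=
  ∀ i, discountFactor α ω u ζ (u i) = p i

variable {Ω : Type*} [MeasurableSpace Ω]

/-- The process `X` is a (strong) solution of the Ornstein-Uhlenbeck equation
`dX_t = -a X_t dt + σ dB_t`: it is a process with almost surely continuous paths and, almost
surely, `X_t = X_0 - a ∫_0^t X_s ds + σ B_t` for all `t ≥ 0`. As `σ` is constant, the stochastic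
integral `∫_0^t σ dB_s` is `σ B_t` (a Brownian motion starts at `0` almost surely). -/
structure IsOrnsteinUhlenbeck (a σ : ℝ) (B X : ℝ≥0 → Ω → ℝ) (μ : Measure Ω) : Prop where
  aemeasurable : ∀ t, AEMeasurable (X t) μ
  cont : ∀ᵐ η ∂μ, Continuous fun t ↦ X t η
  eqn : ∀ᵐ η ∂μ, ∀ t : ℝ≥0,
    X t η = X 0 η - a * (∫ s in (0 : ℝ)..t, X s.toNNReal η) + σ * B t η

/-- The process `Y_t = e^{-ω t} (1 + ∫_0^t X_s ds)`. -/
def priceProcess (ω : ℝ) (X : ℝ≥0 → Ω → ℝ) (t : ℝ≥0) (η : Ω) : ℝ :=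
  Real.exp (-ω * t) * (1 + ∫ s in (0 : ℝ)..t, X s.toNNReal η)

/-- `HasCondExpAt Z V v c μ` says that the conditional expectation `E[Z | V = v]` is `c`.

The function `x ↦ E[Z | V = x]`, the mean of the regular conditional distribution of `Z` given
`V = x`, is determined up to null sets of the law of `V`. Its value at a single point `v` is that
of its continuous version `g`, where `v` lies in the support of the law of `V`, so that the value
`g v` does not depend on the choice of `g` (see `HasCondExpAt.unique`). -/
structure HasCondExpAt {N : ℕ} (Z : Ω → ℝ) (V : Ω → Fin N → ℝ) (v : Fin N → ℝ) (c : ℝ)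
    (μ : Measure Ω) [IsProbabilityMeasure μ] : Prop where
  integrable : Integrable Z μ
  mem_support : v ∈ (μ.map V).support
  exists_version : ∃ g : (Fin N → ℝ) → ℝ, Continuous g ∧
    (∀ᵐ x ∂μ.map V, g x = ∫ z, z ∂condDistrib Z V μ x) ∧ g v = c

theorem HasCondExpAt.unique {N : ℕ} {Z : Ω → ℝ} {V : Ω → Fin N → ℝ} {v : Fin N → ℝ} {c d : ℝ}
    {μ : Measure Ω} [IsProbabilityMeasure μ]
    (hc : HasCondExpAt Z V v c μ) (hd : HasCondExpAt Z V v d μ) : c = d := by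
  obtain ⟨g, hg, hg', rfl⟩ := hc.exists_version
  obtain ⟨f, hf, hf', rfl⟩ := hd.exists_version
  by_contra hne
  have hopen : IsOpen {x | g x ≠ f x} := isOpen_ne_fun hg hf
  have hpos := (Measure.mem_support_iff_forall v).1 hc.mem_support _ (hopen.mem_nhds hne)
  have h0 : ∀ᵐ x ∂μ.map V, g x = f x := by
    filter_upwards [hg', hf'] with x h1 h2 using h1.trans h2.symm
  exact hpos.ne' (ae_iff.1 h0)

end

end SmithWilson

/-!
The Ornstein–Uhlenbeck equation is linear, so it can be solved pathwise: with the forcing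
`V_t = X_0 + α^{3/2} B_t`, variation of constants gives
`∫_0^t X_s ds = ∫_0^t e^{-α (t - r)} V_r dr` (`IsOrnsteinUhlenbeck.integral_eq`). Hence `Y` is, up to
a deterministic affine change, the integral `J` of the continuous Gaussian process `V` against a
continuous kernel.

Almost sure limits of centered Gaussian processes are centered Gaussian, and their covariances
converge to those of the limit (`isGaussianProcess_of_tendsto`), because a limit of the functions
`exp (-v_n t² / 2)` that is a characteristic function forces `v_n` to converge. Applied to Riemann
sums, this shows that `V` and `J` are jointly Gaussian and that a covariance with `J_t` is the
integral of the covariances with `V_r` (`isGaussianProcess_sumElim_weightedIntegral`). Using this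
twice reduces `Cov(J_s, J_t)` to two elementary integrals, which yield the Wilson function.

The covariance matrix of `(Y_{u_1}, …, Y_{u_N})` is positive definite: if `∑ c_i J_{u_i}` has
variance zero, it is uncorrelated with every `V_a`; comparing `a = u_k`, the largest tenor with
`c_k ≠ 0`, with the next smaller such tenor leaves only the term of `J_{u_k}`, whose two covariances
differ (`eq_zero_of_variance_sum_ouIntegral_eq_zero`). So the linear system for the weights is
uniquely solvable and the law of the vector has full support. Finally the linear regression of `Y_t`
on the vector has a residual that is uncorrelated with it, hence independent of it, so that the
regression function is the continuous version of the conditional expectation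
(`hasCondExpAt_of_covariance_eq`). By the symmetry of the covariance matrix, its value at the prices
is the discount curve.
-/

namespace SmithWilson

open Filter Topology Matrix MatrixOrder

variable {Ω : Type*} {mΩ : MeasurableSpace Ω} {μ : Measure Ω}

/-! ### Limits and linear transformations of Gaussian processes -/

theorem charFun_map_eq_of_integral_eq_zero {Z : Ω → ℝ}
    (hZ : HasGaussianLaw Z μ) (h0 : μ[Z] = 0) (t : ℝ) :
    charFun (μ.map Z) t = (Real.exp (-(Var[Z; μ] * t ^ 2 / 2)) : ℂ) := by
  rw [hZ.map_eq_gaussianReal, charFun_gaussianReal, h0]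
  simp [variance_nonneg]

/-- An almost sure limit of centered real Gaussian variables is centered Gaussian, and the variances
converge. No bound on the variances is needed: the limit characteristic function is nonzero near `0`,
so the variances can be read off from it. -/
theorem hasGaussianLaw_of_tendsto {Z : ℕ → Ω → ℝ} {Y : Ω → ℝ}
    (hZ : ∀ n, HasGaussianLaw (Z n) μ) (h0 : ∀ n, μ[Z n] = 0)
    (hlim : ∀ᵐ η ∂μ, Tendsto (fun n ↦ Z n η) atTop (𝓝 (Y η))) :
    HasGaussianLaw Y μ ∧ μ[Y] = 0 ∧
      Tendsto (fun n ↦ Var[Z n; μ]) atTop (𝓝 Var[Y; μ]) := by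
  have := (hZ 0).isProbabilityMeasure
  have hY : AEMeasurable Y μ :=
    aemeasurable_of_tendsto_metrizable_ae atTop (fun n ↦ (hZ n).aemeasurable) hlim
  have : IsProbabilityMeasure (μ.map Y) := Measure.isProbabilityMeasure_map hY
  have hφ (t : ℝ) : Tendsto (fun n ↦ (Real.exp (-(Var[Z n; μ] * t ^ 2 / 2)) : ℂ)) atTop
      (𝓝 (charFun (μ.map Y) t)) := by
    simp_rw [← fun n ↦ charFun_map_eq_of_integral_eq_zero (hZ n) (h0 n) t, charFun_apply_real]
    rw [integral_map hY (by fun_prop)]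
    simp_rw [fun n ↦ integral_map (hZ n).aemeasurable
      (f := fun x : ℝ ↦ Complex.exp (t * x * Complex.I)) (by fun_prop)]
    refine tendsto_integral_of_dominated_convergence (fun _ ↦ 1) (fun n ↦ ?_)
      (integrable_const _) (fun n ↦ ?_) ?_
    · have := (hZ n).aemeasurable
      exact AEMeasurable.aestronglyMeasurable (by fun_prop)
    · refine .of_forall fun η ↦ ?_
      rw [← Complex.ofReal_mul, Complex.norm_exp_ofReal_mul_I]
    · filter_upwards [hlim] with η h
      have hc : Continuous fun x : ℝ ↦ Complex.exp (t * x * Complex.I) := by fun_prop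
      exact (hc.tendsto _).comp h
  -- the limit characteristic function does not vanish near `0`
  obtain ⟨t, ht0, ht⟩ : ∃ t : ℝ, t ≠ 0 ∧ charFun (μ.map Y) t ≠ 0 := by
    have h1 : ∀ᶠ t in 𝓝 (0 : ℝ), charFun (μ.map Y) t ≠ 0 :=
      (continuous_charFun.tendsto 0).eventually_ne (by simp)
    have h2 : ∀ᶠ t in 𝓝[≠] (0 : ℝ), charFun (μ.map Y) t ≠ 0 := h1.filter_mono nhdsWithin_le_nhds
    exact (h2.and self_mem_nhdsWithin).exists.imp fun t h ↦ ⟨h.2, h.1⟩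
  obtain ⟨v, hv⟩ : ∃ v, Tendsto (fun n ↦ Var[Z n; μ]) atTop (𝓝 v) := by
    have h1 := (hφ t).norm.log (norm_ne_zero_iff.2 ht)
    simp only [Complex.norm_real, Real.norm_eq_abs, Real.abs_exp, Real.log_exp] at h1
    refine ⟨_, (h1.mul_const (-(2 / t ^ 2))).congr fun n ↦ ?_⟩
    field_simp
  have hv0 : 0 ≤ v := ge_of_tendsto' hv fun n ↦ variance_nonneg _ _
  have hlaw : μ.map Y = gaussianReal 0 v.toNNReal := by
    refine Measure.ext_of_charFun (funext fun s ↦ tendsto_nhds_unique (hφ s) ?_)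
    have h1 : Continuous fun w : ℝ ↦ (Real.exp (-(w * s ^ 2 / 2)) : ℂ) := by fun_prop
    have h2 : charFun (gaussianReal 0 v.toNNReal) s = (Real.exp (-(v * s ^ 2 / 2)) : ℂ) := by
      rw [charFun_gaussianReal]
      simp [hv0]
    rw [h2]
    exact (h1.tendsto v).comp hv
  have hL : HasLaw Y (gaussianReal 0 v.toNNReal) μ := ⟨hY, hlaw⟩
  refine ⟨hL.hasGaussianLaw, ?_, ?_⟩
  · rw [hL.integral_eq, integral_id_gaussianReal]
  · rwa [hL.variance_eq, variance_id_gaussianReal, Real.coe_toNNReal _ hv0]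

/-- An almost sure limit of centered Gaussian processes is a centered Gaussian process, and the
covariances converge: this is the one-dimensional case applied to linear functionals of the finite
marginals, and polarization. -/
theorem isGaussianProcess_of_tendsto {T : Type*} {X : ℕ → T → Ω → ℝ} {Y : T → Ω → ℝ}
    (hX : ∀ n, IsGaussianProcess (X n) μ) (h0 : ∀ n t, μ[X n t] = 0)
    (hlim : ∀ t, ∀ᵐ η ∂μ, Tendsto (fun n ↦ X n t η) atTop (𝓝 (Y t η))) :
    IsGaussianProcess Y μ ∧ (∀ t, μ[Y t] = 0) ∧
      ∀ s t, Tendsto (fun n ↦ cov[X n s, X n t; μ]) atTop (𝓝 cov[Y s, Y t; μ]) := by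
  have := (hX 0).isProbabilityMeasure
  have hY (t : T) := hasGaussianLaw_of_tendsto (fun n ↦ (hX n).hasGaussianLaw_eval t)
    (fun n ↦ h0 n t) (hlim t)
  have hYm (t : T) : AEMeasurable (Y t) μ := (hY t).1.aemeasurable
  refine ⟨⟨fun I ↦ ⟨isGaussian_of_isGaussian_map fun L ↦ ?_⟩⟩, fun t ↦ (hY t).2.1, fun s t ↦ ?_⟩
  · rw [AEMeasurable.map_map_of_aemeasurable (g := L) (f := fun η ↦ I.restrict (Y · η))
      L.continuous.aemeasurable (aemeasurable_pi_lambda _ fun i ↦ hYm i)]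
    refine (hasGaussianLaw_of_tendsto (Z := fun n ↦ L ∘ fun η ↦ I.restrict (X n · η))
      (fun n ↦ ((hX n).hasGaussianLaw I).map L) (fun n ↦ ?_) ?_).1.isGaussian_map
    · have h1 := L.integral_comp_comm ((hX n).hasGaussianLaw I).integrable
      simp only [Function.comp_def]
      rw [h1]
      convert map_zero L
      ext i
      exact ((ContinuousLinearMap.proj (R := ℝ) (φ := fun _ : I ↦ ℝ) i).integral_comp_comm
        ((hX n).hasGaussianLaw I).integrable).symm.trans (h0 n i)
    · have h1 : ∀ᵐ η ∂μ, ∀ i : I, Tendsto (fun n ↦ X n i η) atTop (𝓝 (Y i η)) :=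
        ae_all_iff.2 fun i ↦ hlim i
      filter_upwards [h1] with η h
      exact (L.continuous.tendsto _).comp (tendsto_pi_nhds.2 h)
  · have hsum := (hasGaussianLaw_of_tendsto (Z := fun n ↦ X n s + X n t) (Y := Y s + Y t)
      (fun n ↦ (hX n).hasGaussianLaw_add) (fun n ↦ ?_) ?_).2.2
    · have hp (A B : Ω → ℝ) (hA : MemLp A 2 μ) (hB : MemLp B 2 μ) :
          cov[A, B; μ] = (Var[A + B; μ] - Var[A; μ] - Var[B; μ]) / 2 := by
        rw [variance_add hA hB]; ring
      rw [hp _ _ (hY s).1.memLp_two (hY t).1.memLp_two]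
      simp_rw [fun n ↦ hp _ _ ((hX n).hasGaussianLaw_eval s).memLp_two
        ((hX n).hasGaussianLaw_eval t).memLp_two]
      exact ((hsum.sub (hY s).2.2).sub (hY t).2.2).div_const 2
    · rw [integral_add' ((hX n).hasGaussianLaw_eval s).integrable
        ((hX n).hasGaussianLaw_eval t).integrable, h0, h0, add_zero]
    · filter_upwards [hlim s, hlim t] with η h1 h2 using h1.add h2

theorem isGaussianProcess_sum {S T : Type*} {X : T → Ω → ℝ} (hX : IsGaussianProcess X μ)
    {ι : Type*} (I : S → Finset ι) (c : S → ι → ℝ) (τ : S → ι → T) :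
    IsGaussianProcess (fun s η ↦ ∑ i ∈ I s, c s i * X (τ s i) η) μ := by
  classical
  refine hX.of_isGaussianProcess fun s ↦ ⟨(I s).image (τ s),
    ∑ i ∈ (I s).attach, c s i • ContinuousLinearMap.proj
      ⟨τ s i, Finset.mem_image_of_mem _ i.2⟩, fun η ↦ ?_⟩
  simp [← Finset.sum_attach (I s)]

theorem isGaussianProcess_add_const {T : Type*} {Z : T → Ω → ℝ} (hZ : IsGaussianProcess Z μ)
    (m : T → ℝ) : IsGaussianProcess (fun t η ↦ Z t η + m t) μ where
  hasGaussianLaw I := by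
    have h1 := (hZ.hasGaussianLaw I).isGaussian_map
    have h2 : IsGaussian ((μ.map fun η ↦ I.restrict (Z · η)).map
      fun x ↦ x + fun i : I ↦ m i) := inferInstance
    rw [AEMeasurable.map_map_of_aemeasurable (by fun_prop) (hZ.hasGaussianLaw I).aemeasurable] at h2
    exact ⟨h2⟩

theorem covariance_congr_ae {Y Y' Z Z' : Ω → ℝ} (hY : Y =ᵐ[μ] Y') (hZ : Z =ᵐ[μ] Z') :
    cov[Y, Z; μ] = cov[Y', Z'; μ] := by
  rw [covariance, covariance, integral_congr_ae hY, integral_congr_ae hZ]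
  refine integral_congr_ae ?_
  filter_upwards [hY, hZ] with η h1 h2
  rw [h1, h2]

/-! ### Riemann sums and integrals of Gaussian processes -/

/-- The Riemann sums over `n + 1` equal steps, evaluated at the left endpoints. -/
theorem tendsto_riemann_sum {f : ℝ → ℝ} (hf : Continuous f) {t : ℝ} (ht : 0 ≤ t) :
    Tendsto (fun n : ℕ ↦ ∑ i ∈ Finset.range (n + 1), t / (n + 1) * f (i * (t / (n + 1)))) atTop
      (𝓝 (∫ r in (0 : ℝ)..t, f r)) := by
  rw [Metric.tendsto_atTop]
  intro ε hε
  have huc : UniformContinuousOn f (Set.Icc 0 t) :=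
    isCompact_Icc.uniformContinuousOn_of_continuous hf.continuousOn
  obtain ⟨δ, hδ, hδ'⟩ := Metric.uniformContinuousOn_iff.1 huc (ε / (t + 1)) (by positivity)
  obtain ⟨n₀, hn₀⟩ := exists_nat_gt (t / δ)
  refine ⟨n₀, fun n hn ↦ ?_⟩
  have hn1 : (0 : ℝ) < n + 1 := by positivity
  set h : ℝ := t / (n + 1) with hh
  have hh0 : 0 ≤ h := by positivity
  have hnh : (n + 1) * h = t := by rw [hh]; field_simp
  have hhδ : h < δ := by
    rw [hh, div_lt_iff₀ hn1]
    rw [div_lt_iff₀ hδ] at hn₀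
    have : (n₀ : ℝ) ≤ n := by exact_mod_cast hn
    nlinarith
  have hsplit : ∫ r in (0 : ℝ)..t, f r =
      ∑ i ∈ Finset.range (n + 1), ∫ r in (i * h)..((i + 1 : ℕ) * h), f r := by
    rw [intervalIntegral.sum_integral_adjacent_intervals (a := fun i : ℕ ↦ (i : ℝ) * h)
      fun i _ ↦ hf.intervalIntegrable _ _]
    simp [hnh]
  rw [hsplit, dist_eq_norm, ← Finset.sum_sub_distrib]
  calc ‖∑ i ∈ Finset.range (n + 1), (h * f (i * h) - ∫ r in (i * h)..((i + 1 : ℕ) * h), f r)‖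
      ≤ ∑ i ∈ Finset.range (n + 1), ε / (t + 1) * h := by
        refine norm_sum_le_of_le _ fun i hi ↦ ?_
        have hi' : (i : ℝ) + 1 ≤ n + 1 := by exact_mod_cast Finset.mem_range.1 hi
        have hle : (i : ℝ) * h ≤ (i + 1 : ℕ) * h := by push_cast; nlinarith
        have hlast : ((i : ℝ) + 1) * h ≤ t := by rw [← hnh]; gcongr
        have h1 : h * f (i * h) = ∫ r in (i * h)..((i + 1 : ℕ) * h), f (i * h) := by
          rw [intervalIntegral.integral_const, smul_eq_mul]; push_cast; ring
        rw [h1, ← intervalIntegral.integral_sub (by simp) (hf.intervalIntegrable _ _)]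
        refine (intervalIntegral.norm_integral_le_of_norm_le_const (C := ε / (t + 1))
          fun r hr ↦ ?_).trans_eq ?_
        · rw [Set.uIoc_of_le hle] at hr
          obtain ⟨hr1, hr2⟩ := hr
          push_cast at hr2
          have hi0 : 0 ≤ (i : ℝ) * h := by positivity
          refine (hδ' _ ⟨hi0, ?_⟩ _ ⟨?_, ?_⟩ ?_).le
          · linarith
          · linarith
          · linarith
          · rw [dist_comm, Real.dist_eq, abs_of_pos (by linarith)]; linarith
        · rw [abs_of_nonneg (by linarith)]; push_cast; ring
    _ = ε / (t + 1) * t := by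
        rw [Finset.sum_const, Finset.card_range, nsmul_eq_mul, ← hnh]; push_cast; ring
    _ < ε := by
        rw [div_mul_eq_mul_div, div_lt_iff₀ (by positivity)]; nlinarith

/-- The process `t ↦ ∫_0^t w(t,r) V_r dr`, for a kernel `w` that may depend on the upper limit. The
time index of `V` is truncated by `Real.toNNReal`, which has no effect as `0 ≤ r` here. -/
noncomputable def weightedIntegral (w : ℝ≥0 → ℝ → ℝ) (V : ℝ≥0 → Ω → ℝ) (t : ℝ≥0) (η : Ω) : ℝ :=
  ∫ r in (0 : ℝ)..t, w t r * V r.toNNReal η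

section

variable {T : Type*} {G : T → Ω → ℝ} {ρ : ℝ≥0 → T} {w : ℝ≥0 → ℝ → ℝ}

/-- Let `G` be a centered Gaussian process and `r ↦ G (ρ r)` a subfamily of it with continuous paths.
Then `G` and the integral of the subfamily against `w` are jointly Gaussian and centered, and
`Cov(G_a, ∫_0^t w(t,r) G_{ρ r} dr) = ∫_0^t w(t,r) Cov(G_a, G_{ρ r}) dr`. Allowing `G` to be larger
than the integrated family makes it possible to apply this again to the extended process. -/
theorem isGaussianProcess_sumElim_weightedIntegral (hG : IsGaussianProcess G μ)
    (hG0 : ∀ a, μ[G a] = 0)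
    (hcont : ∀ᵐ η ∂μ, Continuous fun r ↦ G (ρ r) η) (hw : ∀ t, Continuous (w t)) :
    IsGaussianProcess (Sum.elim G (weightedIntegral w fun r ↦ G (ρ r))) μ ∧
      (∀ t, μ[weightedIntegral w (fun r ↦ G (ρ r)) t] = 0) ∧
      ∀ (a : T) (t : ℝ≥0) (c : ℝ → ℝ), Continuous c →
        (∀ r : ℝ≥0, r ≤ t → cov[G a, G (ρ r); μ] = c r) →
        cov[G a, weightedIntegral w (fun r ↦ G (ρ r)) t; μ] = ∫ r in (0 : ℝ)..t, w t r * c r := by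
  have hP := hG.isProbabilityMeasure
  -- the integral is the limit of the Riemann sums `R n t`, and `Sum.elim G (R n)` is Gaussian as it
  -- consists of linear combinations of `G`
  let pt (n : ℕ) (t : ℝ≥0) (i : ℕ) : ℝ≥0 := i * (t / (n + 1))
  have hpt (n t i) : ((pt n t i : ℝ≥0) : ℝ) = i * ((t : ℝ) / (n + 1)) := by simp [pt]
  let co (n : ℕ) (t : ℝ≥0) (i : ℕ) : ℝ := t / (n + 1) * w t (pt n t i)
  let R (n : ℕ) (t : ℝ≥0) (η : Ω) : ℝ :=
    ∑ i ∈ Finset.range (n + 1), co n t i * G (ρ (pt n t i)) η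
  have hRlim (f : ℝ≥0 → ℝ) (hf : Continuous f) (t : ℝ≥0) :
      Tendsto (fun n ↦ ∑ i ∈ Finset.range (n + 1), co n t i * f (pt n t i)) atTop
        (𝓝 (∫ r in (0 : ℝ)..t, w t r * f r.toNNReal)) := by
    have h1 := tendsto_riemann_sum (f := fun r ↦ w t r * f r.toNNReal)
      ((hw t).mul (hf.comp continuous_real_toNNReal)) t.2
    refine h1.congr fun n ↦ Finset.sum_congr rfl fun i _ ↦ ?_
    simp only [co, ← mul_assoc, NNReal.val_eq_coe]
    rw [← hpt, Real.toNNReal_coe]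
  have hUG (n : ℕ) : IsGaussianProcess (Sum.elim G (R n)) μ := by
    convert isGaussianProcess_sum hG
      (Sum.elim (fun _ : T ↦ {0}) fun _ : ℝ≥0 ↦ Finset.range (n + 1))
      (Sum.elim (fun _ _ ↦ 1) (co n)) (Sum.elim (fun a _ ↦ a) fun t i ↦ ρ (pt n t i)) with s
    rcases s with a | t
    · simp
    · simp [R]
  have hU0 (n : ℕ) (s : T ⊕ ℝ≥0) : μ[Sum.elim G (R n) s] = 0 := by
    rcases s with a | t
    · exact hG0 a
    · simp only [Sum.elim_inr, R]
      rw [integral_finsetSum _ fun i _ ↦ (hG.hasGaussianLaw_eval _).integrable.const_mul _]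
      refine Finset.sum_eq_zero fun i _ ↦ ?_
      rw [integral_const_mul, hG0, mul_zero]
  obtain ⟨h1, h2, h3⟩ := isGaussianProcess_of_tendsto
    (Y := Sum.elim G (weightedIntegral w fun r ↦ G (ρ r))) hUG hU0 (by
      rintro (a | t)
      · exact .of_forall fun η ↦ tendsto_const_nhds
      · filter_upwards [hcont] with η hη using hRlim _ hη t)
  refine ⟨h1, fun t ↦ h2 (Sum.inr t), fun a t c hc hac ↦ ?_⟩
  refine tendsto_nhds_unique (h3 (Sum.inl a) (Sum.inr t)) ?_
  have h4 := hRlim (fun r ↦ c r) (hc.comp NNReal.continuous_coe) t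
  have h5 : ∫ r in (0 : ℝ)..t, w t r * c r.toNNReal = ∫ r in (0 : ℝ)..t, w t r * c r := by
    refine intervalIntegral.integral_congr fun r hr ↦ ?_
    rw [Set.uIcc_of_le t.coe_nonneg] at hr
    simp [hr.1]
  rw [← h5]
  refine h4.congr fun n ↦ ?_
  simp only [Sum.elim_inl, Sum.elim_inr, R]
  rw [covariance_fun_sum_right' (fun i _ ↦ (hG.hasGaussianLaw_eval _).memLp_two.const_mul _)
    (hG.hasGaussianLaw_eval _).memLp_two]
  refine Finset.sum_congr rfl fun i hi ↦ ?_
  rw [covariance_const_mul_right, hac]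
  have hi' : (i : ℝ≥0) ≤ n + 1 := by exact_mod_cast (Finset.mem_range.1 hi).le
  calc pt n t i ≤ (n + 1) * (t / (n + 1)) := by simp only [pt]; gcongr
    _ = t := by field_simp

end

/-- The covariance of two integrals, obtained by applying the covariance formula to `V` extended by
its own integral process. -/
theorem covariance_weightedIntegral {V : ℝ≥0 → Ω → ℝ} {w : ℝ≥0 → ℝ → ℝ}
    (hV : IsGaussianProcess V μ) (hV0 : ∀ a, μ[V a] = 0)
    (hcont : ∀ᵐ η ∂μ, Continuous fun r ↦ V r η) (hw : ∀ t, Continuous (w t))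
    {s t : ℝ≥0} {c : ℝ → ℝ} (hc : Continuous c)
    (hac : ∀ r : ℝ≥0, r ≤ s → cov[V r, weightedIntegral w V t; μ] = c r) :
    cov[weightedIntegral w V s, weightedIntegral w V t; μ] = ∫ r in (0 : ℝ)..s, w s r * c r := by
  obtain ⟨h1, h2, -⟩ := isGaussianProcess_sumElim_weightedIntegral (ρ := id) hV hV0 hcont hw
  have h3 := (isGaussianProcess_sumElim_weightedIntegral
    (G := Sum.elim V (weightedIntegral w V)) (ρ := Sum.inl) h1 (by rintro (a | a); exacts [hV0 a, h2 a]) hcont hw).2.2 (Sum.inr t) s c hc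
  rw [covariance_comm]
  exact h3 fun r hr ↦ by rw [covariance_comm]; exact hac r hr

/-! ### Gaussian regression -/

/-- The degenerate case of the Cauchy–Schwarz inequality for covariances. -/
theorem covariance_eq_zero_of_variance_eq_zero [IsProbabilityMeasure μ] {Y Z : Ω → ℝ}
    (hY : MemLp Y 2 μ) (hZ : MemLp Z 2 μ) (h : Var[Z; μ] = 0) : cov[Y, Z; μ] = 0 := by
  have h1 (x : ℝ) : 0 ≤ Var[Y; μ] + 2 * x * cov[Y, Z; μ] := by
    have h2 := variance_nonneg (Y + fun η ↦ x * Z η) μ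
    rw [variance_add hY (hZ.const_mul x), covariance_const_mul_right, variance_const_mul, h] at h2
    linarith
  -- an affine function of `x` that is bounded below has slope zero
  by_contra hne
  have h3 := h1 (-(Var[Y; μ] + 1) / (2 * cov[Y, Z; μ]))
  field_simp at h3
  linarith

section

variable {ι : Type*} [Fintype ι]

theorem isOpenPosMeasure_multivariateGaussian [DecidableEq ι] (m : EuclideanSpace ℝ ι)
    {S : Matrix ι ι ℝ} (hS : S.PosDef) : (multivariateGaussian m S).IsOpenPosMeasure := by
  have : (gaussianReal 0 1).IsOpenPosMeasure :=
    (gaussianReal_absolutelyContinuous' 0 one_ne_zero).isOpenPosMeasure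
  have : (stdGaussian (EuclideanSpace ℝ ι)).IsOpenPosMeasure := by
    rw [← map_pi_eq_stdGaussian]
    exact (PiLp.continuous_toLp 2 _).isOpenPosMeasure_map (WithLp.toLp_surjective 2)
  refine Continuous.isOpenPosMeasure_map (by fun_prop) fun y ↦ ?_
  -- `(√S)⁻¹ = √S S⁻¹`
  have h1 : CFC.sqrt S * (CFC.sqrt S * S⁻¹) = 1 := by
    rw [← mul_assoc, CFC.sqrt_mul_sqrt_self S hS.posSemidef.nonneg,
      Matrix.mul_nonsing_inv _ ((Matrix.isUnit_iff_isUnit_det _).1 hS.isUnit)]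
  refine ⟨toEuclideanCLM (𝕜 := ℝ) (CFC.sqrt S * S⁻¹) (y - m), ?_⟩
  change m + (toEuclideanCLM (𝕜 := ℝ) (CFC.sqrt S) *
    toEuclideanCLM (𝕜 := ℝ) (CFC.sqrt S * S⁻¹)) (y - m) = y
  rw [← map_mul, h1, map_one]
  simp

/-- A Gaussian vector with positive definite covariance matrix has full support. -/
theorem isOpenPosMeasure_map_of_posDef {V : ι → Ω → ℝ}
    (hV : HasGaussianLaw (fun η i ↦ V i η) μ)
    (hS : (Matrix.of fun i j ↦ cov[V i, V j; μ]).PosDef) :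
    (μ.map fun η i ↦ V i η).IsOpenPosMeasure := by
  classical
  have := hV.isProbabilityMeasure
  set S : Matrix ι ι ℝ := Matrix.of fun i j ↦ cov[V i, V j; μ] with hSdef
  let m : EuclideanSpace ℝ ι := WithLp.toLp 2 fun i ↦ μ[V i]
  have hVl : HasGaussianLaw (fun η ↦ WithLp.toLp 2 (V · η)) μ := hV.toLp_pi 2
  have hlaw : μ.map (fun η ↦ WithLp.toLp 2 (V · η)) = multivariateGaussian m S := by
    have := hVl.isGaussian_map
    apply IsGaussian.ext
    · rw [integral_map hVl.aemeasurable (by fun_prop), integral_id_multivariateGaussian']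
      ext i
      exact ((EuclideanSpace.proj (𝕜 := ℝ) i).integral_comp_comm hVl.integrable).symm
    · ext x y
      rw [covarianceBilin_apply_pi fun i ↦ (hV.eval i).memLp_two,
        covarianceBilin_multivariateGaussian hS.posSemidef]
      simp only [dotProduct, mulVec, Finset.mul_sum, hSdef, Matrix.of_apply]
      exact Finset.sum_congr rfl fun i _ ↦ Finset.sum_congr rfl fun j _ ↦ by ring
  have h2 : (μ.map fun η i ↦ V i η) = (multivariateGaussian m S).map WithLp.ofLp := by
    rw [← hlaw, AEMeasurable.map_map_of_aemeasurable (by fun_prop) hVl.aemeasurable]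
    rfl
  rw [h2]
  have := isOpenPosMeasure_multivariateGaussian m hS
  exact (PiLp.continuous_ofLp 2 _).isOpenPosMeasure_map (WithLp.ofLp_surjective 2)

theorem posDef_covariance {V : ι → Ω → ℝ} [IsProbabilityMeasure μ] (hV : ∀ i, MemLp (V i) 2 μ)
    (h : ∀ c : ι → ℝ, Var[fun η ↦ ∑ i, c i * V i η; μ] = 0 → c = 0) :
    (Matrix.of fun i j ↦ cov[V i, V j; μ]).PosDef := by
  refine .of_dotProduct_mulVec_pos (Matrix.ext fun i j ↦ ?_) fun c hc ↦ ?_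
  · simp [covariance_comm]
  · have h1 : star c ⬝ᵥ (Matrix.of fun i j ↦ cov[V i, V j; μ]) *ᵥ c =
        Var[fun η ↦ ∑ i, c i * V i η; μ] := by
      have hm (i : ι) : MemLp (fun η ↦ c i * V i η) 2 μ := (hV i).const_mul _
      rw [← covariance_self (memLp_finsetSum _ fun i _ ↦ hm i).aemeasurable,
        covariance_fun_sum_fun_sum hm hm]
      simp only [dotProduct, mulVec, Finset.mul_sum, Matrix.of_apply, Pi.star_apply,
        star_trivial, covariance_const_mul_left, covariance_const_mul_right]
      exact Finset.sum_congr rfl fun i _ ↦ Finset.sum_congr rfl fun j _ ↦ by ring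
    rw [h1]
    exact (variance_nonneg _ _).lt_of_ne' fun h2 ↦ hc (h c h2)

end

/-- Gaussian regression: if `(Z, V)` is Gaussian, the covariance matrix of `V` is positive definite
and `b` solves the normal equations, then `E[Z | V = v] = E[Z] + ∑ j, b j * (v j - E[V j])`. -/
theorem hasCondExpAt_of_covariance_eq [IsProbabilityMeasure μ] {N : ℕ} {Z : Ω → ℝ}
    {V : Fin N → Ω → ℝ}
    (hG : HasGaussianLaw (fun η ↦ ((fun _ : Unit ↦ Z η), fun i ↦ V i η)) μ)
    (hS : (Matrix.of fun i j ↦ cov[V i, V j; μ]).PosDef) {b : Fin N → ℝ}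
    (hb : ∀ i, cov[Z, V i; μ] = ∑ j, b j * cov[V j, V i; μ]) (v : Fin N → ℝ) :
    HasCondExpAt Z (fun η i ↦ V i η) v (μ[Z] + ∑ j, b j * (v j - μ[V j])) μ := by
  have hVG : HasGaussianLaw (fun η i ↦ V i η) μ := hG.snd
  have hZG : HasGaussianLaw Z μ := hG.fst.eval ()
  have hVi (i : Fin N) : HasGaussianLaw (V i) μ := hVG.eval i
  let g : (Fin N → ℝ) → ℝ := fun x ↦ μ[Z] + ∑ j, b j * (x j - μ[V j])
  have hgc : Continuous g := by fun_prop
  refine ⟨hZG.integrable, ?_, g, hgc, ?_, rfl⟩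
  · have := isOpenPosMeasure_map_of_posDef hVG hS
    rw [Measure.support_eq_univ]
    trivial
  -- `V` is only almost everywhere measurable, but `condDistrib` does not see a change to a
  -- measurable version, for which the σ-algebra `σ(V')` is available
  let V' : Ω → Fin N → ℝ := hVG.aemeasurable.mk _
  have hVV' : (fun η i ↦ V i η) =ᵐ[μ] V' := hVG.aemeasurable.ae_eq_mk
  have hV'm : Measurable V' := hVG.aemeasurable.measurable_mk
  -- the residual is uncorrelated with the Gaussian vector `V` by the normal equations, hence
  -- independent of it
  let R : Ω → ℝ := fun η ↦ Z η - ∑ j, b j * V j η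
  have hRi : Integrable R μ :=
    hZG.integrable.sub (integrable_finsetSum _ fun j _ ↦ (hVi j).integrable.const_mul _)
  have hind : IndepFun R (fun η i ↦ V i η) μ := by
    have h1 : HasGaussianLaw (fun η ↦ ((fun _ : Unit ↦ R η), fun i ↦ V i η)) μ := by
      let p : (Unit → ℝ) × (Fin N → ℝ) →L[ℝ] (Fin N → ℝ) := ContinuousLinearMap.snd ℝ _ _
      let L : (Unit → ℝ) × (Fin N → ℝ) →L[ℝ] (Unit → ℝ) × (Fin N → ℝ) :=
        (ContinuousLinearMap.pi fun _ ↦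
          (ContinuousLinearMap.proj ()).comp (ContinuousLinearMap.fst ℝ _ _) -
            ∑ j, b j • (ContinuousLinearMap.proj j).comp p).prod p
      refine (hG.map L).congr (.of_forall fun η ↦ ?_)
      ext <;> simp [L, p, R]
    have h2 := HasGaussianLaw.indepFun_of_covariance_eval (X := fun _ : Unit ↦ R) h1 fun _ i ↦ by
      rw [covariance_fun_sub_left hZG.memLp_two
        (memLp_finsetSum _ fun j _ ↦ (hVi j).memLp_two.const_mul _) (hVi i).memLp_two,
        covariance_fun_sum_left (fun j ↦ (hVi j).memLp_two.const_mul _) (hVi i).memLp_two, hb]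
      simp_rw [covariance_const_mul_left, sub_self]
    exact h2.comp (measurable_pi_apply ()) measurable_id
  have hind' : IndepFun R V' μ := hind.congr (.refl _ _) hVV'
  let R' : Ω → ℝ := hRi.aemeasurable.mk R
  have hRR' : R =ᵐ[μ] R' := hRi.aemeasurable.ae_eq_mk
  have hR'm : Measurable R' := hRi.aemeasurable.measurable_mk
  have hind'' : IndepFun R' V' μ := hind'.congr hRR' (.refl _ _)
  have hle : MeasurableSpace.comap V' inferInstance ≤ mΩ := hV'm.comap_le
  have hRc : μ[R' | MeasurableSpace.comap V' inferInstance] =ᵐ[μ] fun _ ↦ μ[R'] :=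
    condExp_indep_eq hR'm.comap_le hle
      (Measurable.stronglyMeasurable (comap_measurable R')) hind''
  let F : (Fin N → ℝ) → ℝ := fun x ↦ ∑ j, b j * x j
  have hFm : StronglyMeasurable[MeasurableSpace.comap V' inferInstance] (F ∘ V') := by
    have hF : Measurable F := by fun_prop
    exact (hF.comp (comap_measurable V')).stronglyMeasurable
  have hFV : F ∘ V' =ᵐ[μ] fun η ↦ ∑ j, b j * V j η := by
    filter_upwards [hVV'] with η h
    simp only [Function.comp_apply, F, ← h]
  have hFi : Integrable (F ∘ V') μ :=
    (integrable_finsetSum _ fun j _ ↦ (hVi j).integrable.const_mul _).congr hFV.symm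
  have hZ : Z =ᵐ[μ] R' + F ∘ V' := by
    filter_upwards [hRR', hFV] with η h1 h2
    rw [Pi.add_apply, ← h1, h2]
    simp [R]
  have hR'i : Integrable R' μ := hRi.congr hRR'
  have hRmean : μ[R'] = μ[Z] - ∑ j, b j * μ[V j] := by
    rw [← integral_congr_ae hRR', integral_sub hZG.integrable
      (integrable_finsetSum _ fun j _ ↦ (hVi j).integrable.const_mul _),
      integral_finsetSum _ fun j _ ↦ (hVi j).integrable.const_mul _]
    simp_rw [integral_const_mul]
  have hcond : μ[Z | MeasurableSpace.comap V' inferInstance] =ᵐ[μ] g ∘ V' := by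
    filter_upwards [condExp_congr_ae (m := MeasurableSpace.comap V' inferInstance) hZ,
      condExp_add hR'i hFi (MeasurableSpace.comap V' inferInstance), hRc] with η h1 h2 h3
    rw [h1, h2, Pi.add_apply, h3, condExp_of_stronglyMeasurable hle hFm hFi, hRmean]
    simp only [g, F, Function.comp_apply, mul_sub, Finset.sum_sub_distrib]
    ring
  have hcd := condExp_ae_eq_integral_condDistrib' hV'm hZG.integrable
  rw [condDistrib_congr_right hVV', Measure.map_congr hVV']
  have hmeas : MeasurableSet {x | g x = ∫ z, z ∂condDistrib Z V' μ x} := by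
    refine measurableSet_eq_fun hgc.measurable ?_
    exact (StronglyMeasurable.integral_kernel (stronglyMeasurable_id)).measurable
  rw [ae_map_iff hV'm.aemeasurable hmeas]
  filter_upwards [hcond, hcd] with η h1 h2
  rw [← h2, h1, Function.comp_apply]

/-! ### The integrated Ornstein–Uhlenbeck process -/

/-- Variation of constants: for `F t = ∫_0^t f`, the equation reads `F' = v - a F`, `F 0 = 0`. -/
theorem integral_eq_of_linear_equation {a : ℝ} {f v : ℝ → ℝ} (hf : Continuous f)
    (hv : Continuous v) {t : ℝ} (ht : 0 ≤ t)
    (h : ∀ s, 0 ≤ s → f s = v s - a * ∫ r in (0 : ℝ)..s, f r) :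
    ∫ r in (0 : ℝ)..t, f r = ∫ r in (0 : ℝ)..t, Real.exp (-a * (t - r)) * v r := by
  have hderiv : ∀ s ∈ Set.uIcc 0 t, HasDerivAt
      (fun s ↦ Real.exp (-a * (t - s)) * ∫ r in (0 : ℝ)..s, f r)
      (Real.exp (-a * (t - s)) * v s) s := by
    intro s hs
    rw [Set.uIcc_of_le ht] at hs
    have h1 : HasDerivAt (fun s ↦ ∫ r in (0 : ℝ)..s, f r) (f s) s :=
      (hf.integral_hasStrictDerivAt 0 s).hasDerivAt
    have h2 : HasDerivAt (fun s ↦ Real.exp (-a * (t - s))) (Real.exp (-a * (t - s)) * a) s := by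
      refine (((hasDerivAt_id' s).const_sub t).const_mul (-a)).exp.congr_deriv ?_
      simp
    refine (h2.fun_mul h1).congr_deriv ?_
    rw [h s hs.1]; ring
  rw [intervalIntegral.integral_eq_sub_of_hasDerivAt hderiv
    (Continuous.intervalIntegrable (by fun_prop) _ _)]
  simp

/-- The kernel `e^{-α (t - r)}` that solves the Ornstein–Uhlenbeck equation. -/
noncomputable def ouKernel (α : ℝ) (t : ℝ≥0) (r : ℝ) : ℝ := Real.exp (-α * (t - r))

/-- The forcing `V_t = X_0 + σ B_t` of the integrated Ornstein–Uhlenbeck equation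
`I' = V - a I`, where `I_t = ∫_0^t X_s ds`. -/
def ouForcing (σ : ℝ) (B X : ℝ≥0 → Ω → ℝ) (t : ℝ≥0) (η : Ω) : ℝ := X 0 η + σ * B t η

theorem hasDerivAt_exp_neg_mul_sub (α t r : ℝ) :
    HasDerivAt (fun r ↦ Real.exp (-α * (t - r))) (α * Real.exp (-α * (t - r))) r := by
  refine (((hasDerivAt_id' r).const_sub t).const_mul (-α)).exp.congr_deriv ?_
  ring

theorem integral_exp_mul_linear (α t a : ℝ) :
    ∫ r in (0 : ℝ)..a, Real.exp (-α * (t - r)) * (α ^ 2 + α ^ 3 * r) =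
      α ^ 2 * a * Real.exp (-α * (t - a)) := by
  rw [intervalIntegral.integral_eq_sub_of_hasDerivAt
    (f := fun r ↦ α ^ 2 * r * Real.exp (-α * (t - r))) (fun r _ ↦ ?_)
    (Continuous.intervalIntegrable (by fun_prop) _ _)]
  · simp
  · refine (((hasDerivAt_id' r).const_mul (α ^ 2)).fun_mul
      (hasDerivAt_exp_neg_mul_sub α t r)).congr_deriv ?_
    ring

theorem integral_ouKernel_mul_min_of_le {α a t : ℝ} (h0 : 0 ≤ a) (hat : a ≤ t) :
    ∫ r in (0 : ℝ)..t, Real.exp (-α * (t - r)) * (α ^ 2 + α ^ 3 * min a r) =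
      α + α ^ 2 * a - α * Real.exp (-α * (t - a)) := by
  have hint (x y : ℝ) : IntervalIntegrable
      (fun r ↦ Real.exp (-α * (t - r)) * (α ^ 2 + α ^ 3 * min a r)) volume x y :=
    Continuous.intervalIntegrable (by fun_prop) _ _
  rw [← intervalIntegral.integral_add_adjacent_intervals (hint 0 a) (hint a t)]
  have h1 : ∫ r in (0 : ℝ)..a, Real.exp (-α * (t - r)) * (α ^ 2 + α ^ 3 * min a r) =
      ∫ r in (0 : ℝ)..a, Real.exp (-α * (t - r)) * (α ^ 2 + α ^ 3 * r) := by
    refine intervalIntegral.integral_congr fun r hr ↦ ?_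
    rw [Set.uIcc_of_le h0] at hr
    simp only [min_eq_right hr.2]
  have h2 : ∫ r in a..t, Real.exp (-α * (t - r)) * (α ^ 2 + α ^ 3 * min a r) =
      ∫ r in a..t, (α + α ^ 2 * a) * (α * Real.exp (-α * (t - r))) := by
    refine intervalIntegral.integral_congr fun r hr ↦ ?_
    rw [Set.uIcc_of_le hat] at hr
    simp only [min_eq_left hr.1]
    ring
  rw [h1, h2, integral_exp_mul_linear, intervalIntegral.integral_const_mul,
    intervalIntegral.integral_eq_sub_of_hasDerivAt
      (fun r _ ↦ hasDerivAt_exp_neg_mul_sub α t r)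
      (Continuous.intervalIntegrable (by fun_prop) _ _)]
  simp
  ring

theorem integral_ouKernel_mul_min_of_ge {α a t : ℝ} (h0 : 0 ≤ t) (hat : t ≤ a) :
    ∫ r in (0 : ℝ)..t, Real.exp (-α * (t - r)) * (α ^ 2 + α ^ 3 * min a r) = α ^ 2 * t := by
  have h1 : ∫ r in (0 : ℝ)..t, Real.exp (-α * (t - r)) * (α ^ 2 + α ^ 3 * min a r) =
      ∫ r in (0 : ℝ)..t, Real.exp (-α * (t - r)) * (α ^ 2 + α ^ 3 * r) := by
    refine intervalIntegral.integral_congr fun r hr ↦ ?_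
    rw [Set.uIcc_of_le h0] at hr
    simp only [min_eq_right (hr.2.trans hat)]
  rw [h1, integral_exp_mul_linear]
  simp

theorem integral_ouKernel_mul_cross (α s t : ℝ) :
    ∫ r in (0 : ℝ)..s, Real.exp (-α * (s - r)) *
        (α + α ^ 2 * r - α * Real.exp (-α * (t - r))) =
      α * s - Real.exp (-α * t) * Real.sinh (α * s) := by
  rw [intervalIntegral.integral_eq_sub_of_hasDerivAt
    (f := fun r ↦ α * r * Real.exp (-α * (s - r)) -
      Real.exp (-α * (s - r)) * Real.exp (-α * (t - r)) / 2) (fun r _ ↦ ?_)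
    (Continuous.intervalIntegrable (by fun_prop) _ _)]
  · have h1 : Real.exp (-α * (t - s)) = Real.exp (-α * t) * Real.exp (α * s) := by
      rw [← Real.exp_add]; ring_nf
    have h2 : Real.exp (-(α * s)) = Real.exp (-α * s) := by ring_nf
    simp only [h1, Real.sinh_eq, h2, sub_self, mul_zero, Real.exp_zero, sub_zero]
    ring
  · have hs := hasDerivAt_exp_neg_mul_sub α s r
    have ht := hasDerivAt_exp_neg_mul_sub α t r
    refine ((((hasDerivAt_id' r).const_mul α).fun_mul hs).fun_sub
      ((hs.fun_mul ht).div_const 2)).congr_deriv ?_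
    ring

section

variable {α σ : ℝ} {B X : ℝ≥0 → Ω → ℝ}

theorem IsOrnsteinUhlenbeck.integral_eq (hB : ∀ᵐ η ∂μ, Continuous (B · η))
    (hX : IsOrnsteinUhlenbeck α σ B X μ) :
    ∀ᵐ η ∂μ, ∀ t : ℝ≥0, ∫ s in (0 : ℝ)..t, X s.toNNReal η =
      weightedIntegral (ouKernel α) (ouForcing σ B X) t η := by
  filter_upwards [hB, hX.cont, hX.eqn] with η h1 h2 h3 t
  refine integral_eq_of_linear_equation (f := fun r ↦ X r.toNNReal η)
    (v := fun r ↦ ouForcing σ B X r.toNNReal η)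
    (h2.comp continuous_real_toNNReal) ?_ t.2 fun s hs ↦ ?_
  · have := h1.comp continuous_real_toNNReal
    simp only [Function.comp_def] at this
    unfold ouForcing
    fun_prop
  · rw [h3, Real.coe_toNNReal s hs, ouForcing]; ring

theorem isGaussianProcess_ouForcing (hB : IsGaussianProcess B μ)
    (hX0 : HasGaussianLaw (X 0) μ) (hindep : IndepFun (X 0) (fun η t ↦ B t η) μ) :
    IsGaussianProcess (ouForcing σ B X) μ where
  hasGaussianLaw I := by
    have h1 : HasGaussianLaw (fun η ↦ (X 0 η, I.restrict (B · η))) μ :=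
      IndepFun.hasGaussianLaw hX0 (hB.hasGaussianLaw I)
        (hindep.comp measurable_id (Finset.measurable_restrict I))
    let L : ℝ × (I → ℝ) →L[ℝ] (I → ℝ) := ContinuousLinearMap.pi fun i ↦
      ContinuousLinearMap.fst ℝ ℝ (I → ℝ) +
        σ • (ContinuousLinearMap.proj i).comp (ContinuousLinearMap.snd ℝ ℝ (I → ℝ))
    exact h1.map L

theorem integral_ouForcing (hB : IsPreBrownianReal B μ) (hX0 : HasGaussianLaw (X 0) μ)
    (h0 : μ[X 0] = 0) (t : ℝ≥0) : μ[ouForcing σ B X t] = 0 := by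
  unfold ouForcing
  rw [integral_add hX0.integrable ((hB.integrable_eval t).const_mul σ), h0,
    integral_const_mul, hB.integral_eval]
  simp

theorem covariance_ouForcing (hB : IsPreBrownianReal B μ) (hX0 : HasGaussianLaw (X 0) μ)
    (hindep : IndepFun (X 0) (fun η t ↦ B t η) μ) (s t : ℝ≥0) :
    cov[ouForcing σ B X s, ouForcing σ B X t; μ] = Var[X 0; μ] + σ ^ 2 * min s t := by
  have := hX0.isProbabilityMeasure
  have hBm (r : ℝ≥0) : MemLp (B r) 2 μ := (hB.isGaussianProcess.hasGaussianLaw_eval r).memLp_two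
  have hBm' (r : ℝ≥0) : MemLp (fun η ↦ σ * B r η) 2 μ := (hBm r).const_mul σ
  have hXB (r : ℝ≥0) : cov[X 0, B r; μ] = 0 :=
    (hindep.comp measurable_id (measurable_pi_apply r)).covariance_eq_zero hX0.memLp_two (hBm r)
  change cov[X 0 + (fun η ↦ σ * B s η), X 0 + (fun η ↦ σ * B t η); μ] = _
  rw [covariance_add_left hX0.memLp_two (hBm' s) (hX0.memLp_two.add (hBm' t)),
    covariance_add_right hX0.memLp_two hX0.memLp_two (hBm' t),
    covariance_add_right (hBm' s) hX0.memLp_two (hBm' t),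
    covariance_const_mul_right, covariance_const_mul_left, covariance_const_mul_left,
    covariance_const_mul_right, covariance_comm (B s), hXB, hXB, hB.covariance_eval,
    covariance_self hX0.aemeasurable]
  push_cast
  ring

end

section

variable {α : ℝ} {B X : ℝ≥0 → Ω → ℝ}

/-- The process `∫_0^t e^{-α (t - r)} (X_0 + α^{3/2} B_r) dr`, which is almost surely
`∫_0^t X_s ds`. -/
noncomputable def ouIntegral (α : ℝ) (B X : ℝ≥0 → Ω → ℝ) : ℝ≥0 → Ω → ℝ :=
  weightedIntegral (ouKernel α) (ouForcing (α ^ (3 / 2 : ℝ)) B X)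

theorem rpow_three_halves_sq (hα : 0 < α) : (α ^ (3 / 2 : ℝ)) ^ 2 = α ^ 3 := by
  rw [← Real.rpow_natCast, ← Real.rpow_mul hα.le, ← Real.rpow_natCast]
  norm_num

/-- The forcing and the integrated Ornstein–Uhlenbeck process are jointly Gaussian; their covariances.
The covariance of the integrated process is the Wilson function for `ω = 0`. -/
theorem isGaussianProcess_sumElim_ouIntegral (hα : 0 < α) (hB : IsBrownianReal B μ)
    (hX0 : HasLaw (X 0) (gaussianReal 0 (α ^ 2).toNNReal) μ)
    (hindep : IndepFun (X 0) (fun η t ↦ B t η) μ) :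
    IsGaussianProcess (Sum.elim (ouForcing (α ^ (3 / 2 : ℝ)) B X) (ouIntegral α B X)) μ ∧
    (∀ t, μ[ouIntegral α B X t] = 0) ∧
    (∀ a t, cov[ouForcing (α ^ (3 / 2 : ℝ)) B X a, ouIntegral α B X t; μ] =
      ∫ r in (0 : ℝ)..t, Real.exp (-α * (t - r)) * (α ^ 2 + α ^ 3 * min (a : ℝ) r)) ∧
    ∀ s t : ℝ≥0, cov[ouIntegral α B X s, ouIntegral α B X t; μ] =
      α * min (s : ℝ) t - Real.exp (-α * max (s : ℝ) t) * Real.sinh (α * min (s : ℝ) t) := by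
  have hX0G : HasGaussianLaw (X 0) μ := hX0.hasGaussianLaw
  have hX0m : μ[X 0] = 0 := by rw [hX0.integral_eq, integral_id_gaussianReal]
  have hX0v : Var[X 0; μ] = α ^ 2 := by
    rw [hX0.variance_eq, variance_id_gaussianReal, Real.coe_toNNReal _ (sq_nonneg α)]
  have hV := isGaussianProcess_ouForcing (σ := α ^ (3 / 2 : ℝ)) hB.isGaussianProcess hX0G hindep
  have hV0 := integral_ouForcing (σ := α ^ (3 / 2 : ℝ)) hB.toIsPreBrownianReal hX0G hX0m
  have hVc : ∀ᵐ η ∂μ, Continuous fun r ↦ ouForcing (α ^ (3 / 2 : ℝ)) B X r η := by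
    filter_upwards [hB.cont] with η h
    unfold ouForcing
    fun_prop
  have hw (t : ℝ≥0) : Continuous (ouKernel α t) := by unfold ouKernel; fun_prop
  obtain ⟨h1, h2, h3⟩ := isGaussianProcess_sumElim_weightedIntegral (ρ := id) hV hV0 hVc hw
  have h4 (a t : ℝ≥0) : cov[ouForcing (α ^ (3 / 2 : ℝ)) B X a, ouIntegral α B X t; μ] =
      ∫ r in (0 : ℝ)..t, Real.exp (-α * (t - r)) * (α ^ 2 + α ^ 3 * min (a : ℝ) r) := by
    refine h3 a t (fun r ↦ α ^ 2 + α ^ 3 * min (a : ℝ) r) (by fun_prop) fun r _ ↦ ?_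
    rw [id, covariance_ouForcing hB.toIsPreBrownianReal hX0G hindep, hX0v,
      rpow_three_halves_sq hα, NNReal.coe_min]
  refine ⟨h1, h2, h4, fun s t ↦ ?_⟩
  wlog hst : s ≤ t generalizing s t
  · rw [covariance_comm, this t s (le_of_not_ge hst), min_comm, max_comm]
  rw [min_eq_left (NNReal.coe_le_coe.2 hst), max_eq_right (NNReal.coe_le_coe.2 hst),
    ← integral_ouKernel_mul_cross]
  refine covariance_weightedIntegral hV hV0 hVc hw (by fun_prop) fun r hr ↦ (h4 r t).trans ?_
  exact integral_ouKernel_mul_min_of_le r.2 (NNReal.coe_le_coe.2 (hr.trans hst))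

/-- The integrated Ornstein–Uhlenbeck process at distinct positive times is non-degenerate. -/
theorem eq_zero_of_variance_sum_ouIntegral_eq_zero (hα : 0 < α) (hB : IsBrownianReal B μ)
    (hX0 : HasLaw (X 0) (gaussianReal 0 (α ^ 2).toNNReal) μ)
    (hindep : IndepFun (X 0) (fun η t ↦ B t η) μ) {ι : Type*} [Fintype ι] {u : ι → ℝ≥0}
    (hu : Function.Injective u) (hu0 : ∀ i, 0 < u i) {c : ι → ℝ}
    (hc : Var[fun η ↦ ∑ i, c i * ouIntegral α B X (u i) η; μ] = 0) : c = 0 := by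
  classical
  obtain ⟨hG, -, hVJ, -⟩ := isGaussianProcess_sumElim_ouIntegral hα hB hX0 hindep
  have := hG.isProbabilityMeasure
  have hV (a : ℝ≥0) : MemLp (ouForcing (α ^ (3 / 2 : ℝ)) B X a) 2 μ :=
    (hG.hasGaussianLaw_eval (.inl a)).memLp_two
  have hJ (i : ι) : MemLp (fun η ↦ c i * ouIntegral α B X (u i) η) 2 μ :=
    (hG.hasGaussianLaw_eval (.inr (u i))).memLp_two.const_mul _
  have h0 (a : ℝ≥0) :
      ∑ i, c i * cov[ouForcing (α ^ (3 / 2 : ℝ)) B X a, ouIntegral α B X (u i); μ] = 0 := by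
    have h1 := covariance_eq_zero_of_variance_eq_zero (hV a)
      (memLp_finsetSum _ fun i _ ↦ hJ i) hc
    rw [covariance_fun_sum_right hJ (hV a)] at h1
    simpa only [covariance_const_mul_right] using h1
  by_contra hne
  let S : Finset ι := Finset.univ.filter fun i ↦ c i ≠ 0
  have hS : S.Nonempty := by
    obtain ⟨i, hi⟩ := Function.ne_iff.1 hne
    exact ⟨i, by simpa [S] using hi⟩
  obtain ⟨k, hkS, hk⟩ := S.exists_max_image u hS
  have hck : c k ≠ 0 := by simpa [S] using hkS
  -- the largest of the other active times, or `0` if there is none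
  let a : ℝ≥0 := (S.erase k).sup u
  have hak : a < u k := by
    refine (Finset.sup_lt_iff (by simpa using hu0 k)).2 fun i hi ↦ ?_
    exact (hk i (Finset.mem_of_mem_erase hi)).lt_of_ne fun h ↦ Finset.ne_of_mem_erase hi (hu h)
  -- for `t ≤ a` the covariance of `V_a` and `J_t` does not depend on `a`
  have hother (i : ι) (hik : i ≠ k) :
      c i * cov[ouForcing (α ^ (3 / 2 : ℝ)) B X (u k), ouIntegral α B X (u i); μ] =
        c i * cov[ouForcing (α ^ (3 / 2 : ℝ)) B X a, ouIntegral α B X (u i); μ] := by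
    by_cases hci : c i = 0
    · simp [hci]
    have hiS : i ∈ S.erase k := by simp [S, hik, hci]
    have hia : u i ≤ a := Finset.le_sup (f := u) hiS
    rw [hVJ, hVJ, integral_ouKernel_mul_min_of_ge (u i).coe_nonneg (NNReal.coe_le_coe.2 hia),
      integral_ouKernel_mul_min_of_ge (u i).coe_nonneg (NNReal.coe_le_coe.2 (hia.trans hak.le))]
  have h1 := (h0 (u k)).trans (h0 a).symm
  rw [← Finset.add_sum_erase _ _ (Finset.mem_univ k),
    ← Finset.add_sum_erase Finset.univ
      (fun i ↦ c i * cov[ouForcing (α ^ (3 / 2 : ℝ)) B X a, ouIntegral α B X (u i); μ])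
      (Finset.mem_univ k),
    Finset.sum_congr rfl fun i hi ↦ hother i (Finset.ne_of_mem_erase hi)] at h1
  have h2 := mul_left_cancel₀ hck (add_right_cancel h1)
  rw [hVJ, hVJ, integral_ouKernel_mul_min_of_le (u k).coe_nonneg le_rfl,
    integral_ouKernel_mul_min_of_le a.coe_nonneg (NNReal.coe_le_coe.2 hak.le)] at h2
  -- what is left is `α a - e^{-α (u k - a)} = α (u k) - 1`, against the strict convexity of `exp`
  have h3 : (a : ℝ) < u k := hak
  have h4 : -α * ((u k : ℝ) - a) + 1 < Real.exp (-α * ((u k : ℝ) - a)) :=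
    Real.add_one_lt_exp (mul_neg_of_neg_of_pos (by linarith) (by linarith)).ne
  simp only [sub_self, mul_zero, Real.exp_zero] at h2
  nlinarith

theorem priceProcess_ae_eq (hB : IsBrownianReal B μ)
    (hX : IsOrnsteinUhlenbeck α (α ^ (3 / 2 : ℝ)) B X μ) (ω : ℝ) (t : ℝ≥0) :
    (fun η ↦ Real.exp (-ω * t) * ouIntegral α B X t η + Real.exp (-ω * t)) =ᵐ[μ]
      priceProcess ω X t := by
  filter_upwards [hX.integral_eq hB.cont] with η h
  rw [priceProcess, h t, ouIntegral]
  ring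

end

end SmithWilson

open SmithWilson Matrix

theorem theorem1 {Ω : Type*} [MeasurableSpace Ω] (μ : Measure Ω) [IsProbabilityMeasure μ]
    (α ω : ℝ) (hα : 0 < α) (B X : ℝ≥0 → Ω → ℝ)
    (hB : IsBrownianReal B μ)
    (hX : SmithWilson.IsOrnsteinUhlenbeck α (α ^ (3 / 2 : ℝ)) B X μ)
    (hX0 : HasLaw (X 0) (gaussianReal 0 (α ^ 2).toNNReal) μ)
    (hindep : IndepFun (X 0) (fun η t ↦ B t η) μ) :
    -- `Y` is a Gaussian process with mean `e^{-ω t}` and covariance `W`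
    (IsGaussianProcess (SmithWilson.priceProcess ω X) μ ∧
      (∀ t : ℝ≥0, ∫ η, SmithWilson.priceProcess ω X t η ∂μ = Real.exp (-ω * t)) ∧
      (∀ s t : ℝ≥0, cov[SmithWilson.priceProcess ω X s, SmithWilson.priceProcess ω X t; μ] =
        SmithWilson.wilson α ω s t)) ∧
    -- the weights are well defined, and `P(t) = E[Y_t | Y_{u_i} = p_i, i = 1, …, N]`
    ∀ (N : ℕ) (u : Fin N → ℝ≥0), Function.Injective u → (∀ i, 0 < u i) → ∀ p : Fin N → ℝ,
      (∃! ζ : Fin N → ℝ, SmithWilson.IsFit α ω u p ζ) ∧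
      ∀ ζ : Fin N → ℝ, SmithWilson.IsFit α ω u p ζ → ∀ t : ℝ≥0,
        SmithWilson.HasCondExpAt (SmithWilson.priceProcess ω X t)
          (fun η i ↦ SmithWilson.priceProcess ω X (u i) η) p
          (SmithWilson.discountFactor α ω u ζ t) μ := by
  obtain ⟨hG, hJ0, -, hcov⟩ := isGaussianProcess_sumElim_ouIntegral hα hB hX0 hindep
  have hJ (t : ℝ≥0) : HasGaussianLaw (ouIntegral α B X t) μ := hG.hasGaussianLaw_eval (.inr t)
  have hY := priceProcess_ae_eq hB hX ω
  have hYG : IsGaussianProcess (priceProcess ω X) μ :=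
    (isGaussianProcess_add_const ((hG.comp_right Sum.inr).smul fun t : ℝ≥0 ↦ Real.exp (-ω * t))
      fun t : ℝ≥0 ↦ Real.exp (-ω * t)).congr hY
  have hYm (t : ℝ≥0) : ∫ η, priceProcess ω X t η ∂μ = Real.exp (-ω * t) := by
    rw [← integral_congr_ae (hY t), integral_add ((hJ t).integrable.const_mul _)
      (integrable_const _), integral_const_mul, hJ0]
    simp
  have hYc (s t : ℝ≥0) : cov[priceProcess ω X s, priceProcess ω X t; μ] = wilson α ω s t := by
    rw [← covariance_congr_ae (hY s) (hY t),
      covariance_add_const_left ((hJ s).integrable.const_mul _),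
      covariance_add_const_right ((hJ t).integrable.const_mul _),
      covariance_const_mul_left, covariance_const_mul_right, hcov, wilson, mul_add, Real.exp_add]
    ring
  refine ⟨⟨hYG, hYm, hYc⟩, fun N u hu hu0 p ↦ ?_⟩
  have hS : (Matrix.of fun i j ↦
      cov[priceProcess ω X (u i), priceProcess ω X (u j); μ]).PosDef := by
    refine posDef_covariance (fun i ↦ (hYG.hasGaussianLaw_eval (u i)).memLp_two) fun c hc ↦ ?_
    have h1 : (fun η ↦ ∑ i, c i * priceProcess ω X (u i) η) =ᵐ[μ] fun η ↦
        (∑ i, (c i * Real.exp (-ω * u i)) * ouIntegral α B X (u i) η) +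
          ∑ i, c i * Real.exp (-ω * u i) := by
      have h2 : ∀ᵐ η ∂μ, ∀ i, _ = _ := ae_all_iff.2 fun i ↦ hY (u i)
      filter_upwards [h2] with η h
      simp_rw [← h, mul_add, Finset.sum_add_distrib, mul_assoc]
    rw [variance_congr h1, variance_add_const
      (integrable_finsetSum _ fun i _ ↦ (hJ (u i)).integrable.const_mul _).aestronglyMeasurable]
      at hc
    have h3 := eq_zero_of_variance_sum_ouIntegral_eq_zero hα hB hX0 hindep hu hu0 hc
    ext i
    have h4 := congrFun h3 i
    simpa [(Real.exp_pos _).ne'] using h4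
  set S : Matrix (Fin N) (Fin N) ℝ :=
    Matrix.of fun i j ↦ cov[priceProcess ω X (u i), priceProcess ω X (u j); μ] with hSdef
  have hunit : IsUnit S := hS.isUnit
  have hSij (i j) : S i j = wilson α ω (u i) (u j) := hYc _ _
  have hfit (ζ : Fin N → ℝ) : IsFit α ω u p ζ ↔
      S.mulVec ζ = fun i ↦ p i - Real.exp (-ω * u i) := by
    rw [funext_iff]
    refine forall_congr' fun i ↦ ?_
    simp only [discountFactor, mulVec, dotProduct, hSij, mul_comm (ζ _)]
    constructor <;> intro h <;> linarith
  have hbij : Function.Bijective S.mulVec :=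
    ⟨Matrix.mulVec_injective_iff_isUnit.2 hunit, Matrix.mulVec_surjective_iff_isUnit.2 hunit⟩
  refine ⟨?_, fun ζ hζ t ↦ ?_⟩
  · simp_rw [hfit]
    exact hbij.existsUnique _
  obtain ⟨b, hb⟩ := hbij.2 fun i ↦ cov[priceProcess ω X t, priceProcess ω X (u i); μ]
  have hb' (i : Fin N) : cov[priceProcess ω X t, priceProcess ω X (u i); μ] =
      ∑ j, b j * cov[priceProcess ω X (u j), priceProcess ω X (u i); μ] := by
    rw [← congrFun hb i]
    simp only [mulVec, dotProduct, hSdef, Matrix.of_apply]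
    exact Finset.sum_congr rfl fun j _ ↦ by rw [covariance_comm, mul_comm]
  have hjoint : HasGaussianLaw (fun η ↦ ((fun _ : Unit ↦ priceProcess ω X t η),
      fun i ↦ priceProcess ω X (u i) η)) μ := by
    classical
    let I : Finset ℝ≥0 := insert t (Finset.univ.image u)
    let L : (I → ℝ) →L[ℝ] (Unit → ℝ) × (Fin N → ℝ) :=
      (ContinuousLinearMap.pi fun _ ↦ ContinuousLinearMap.proj ⟨t, by simp [I]⟩).prod
        (ContinuousLinearMap.pi fun i ↦ ContinuousLinearMap.proj ⟨u i, by simp [I]⟩)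
    exact (hYG.hasGaussianLaw I).map L
  convert hasCondExpAt_of_covariance_eq hjoint hS hb' p using 1
  -- the regression coefficients `b` invert the covariance matrix on `W(t, ·)`, the weights `ζ` invert
  -- it on `p`; both give the same value as the matrix is symmetric
  have h1 (j : Fin N) : p j - ∫ η, priceProcess ω X (u j) η ∂μ =
      ∑ k, cov[priceProcess ω X (u j), priceProcess ω X (u k); μ] * ζ k := by
    rw [hYm]
    exact (congrFun ((hfit ζ).1 hζ) j).symm
  simp_rw [h1, hYm, discountFactor, ← hYc, hb', Finset.mul_sum]
  rw [Finset.sum_comm]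
  congr 1
  exact Finset.sum_congr rfl fun _ _ ↦ Finset.sum_congr rfl fun _ _ ↦ by ring
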